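/- Let $\mathcal H$ be a complex Hilbert space and let $\mathcal K=\mathcal K(\mathcal H)$ be the $C^*$-algebra of all compact operators on $\mathcal H$. Let $E$ be a Hilbert $\mathcal K$-module, that is, a left $\mathcal K$-module with a $\mathcal K$-valued inner product $\langle\cdot,\cdot\rangle$ that is $\mathcal K$-linear in the first variable, satisfies $\langle x,y\rangle=\langle y,x\rangle^*$ and $\langle x,x\rangle\ge 0$ with equality only for $x=0$, and for which $E$ is complete in the norm $\|x\|=\|\langle x,x\rangle\|^{1/2}$. Let $B(E)$ be the algebra of adjointable operators on $E$ and let $K(E)\subseteq B(E)$ be the norm closure of the linear span of the operators $\Theta_{x,y}\colon z\mapsto\langle z,x\rangle y$, $x,y\in E$. For a densely defined $\mathcal K$-linear operator $t\colon \mathrm{Dom}(t)\subseteq E\to E$ the adjoint $t^*$ has domain $\{y\in E:\exists\,y'\in E\ \langle tx,y\rangle=\langle x,y'\rangle\ \text{for all } x\in \mathrm{Dom}(t)\}$, with $t^*y=y'$. The operator $t$ is called regular if it is closed and $\mathcal K$-linear, its domain is a dense submodule, $t^*$ is densely defined and $1+t^*t$ has dense range. Products such as $t^*t$ have their natural domain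 $\mathrm{Dom}(st)=\{x\in\mathrm{Dom}(t): tx\in\mathrm{Dom}(s)\}$. A regular operator $t$ is called Fredholm if there are $G,G'\in B(E)$ such that $Gt$ and $tG'$ are closable, their closures belong to $B(E)$, and $\overline{Gt}-1\in K(E)$, $\overline{tG'}-1\in K(E)$. For a closed submodule $X$ of $E$, an orthonormal basis of $X$ is a set $B\subseteq X$ such that $\langle x,x\rangle$ is a minimal projection of $\mathcal K$ for every $x\in B$ (a projection $e\ne0$ with $e\mathcal K e=\mathbb C e$), $\langle x,y\rangle=0$ for distinct $x,y\in B$, and $B$ generates a dense submodule of $X$. The dimension $\dim_{\mathcal K}X$ is the cardinality of an orthonormal basis of $X$; thus it is finite if and only if $X$ has a finite orthonormal basis. **Theorem.** Let $t$ be a regular operator on $E$. Then $t$ is Fredholm if and only if $\mathrm{Ran}\,t$ is a closed submodule of $E$ and both $\dim_{\mathcal K}\mathrm{Ker}\,t$ and $\dim_{\mathcal K}\mathrm{Ker}\,t^*$ are finite. -/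

import Mathlib

open scoped InnerProductSpace

noncomputable section

/-! ### The C⋆-algebra of compact operators on a Hilbert space -/

section CompactOperators

variable {H : Type*} [NormedAddCommGroup H] [InnerProductSpace ℂ H] [CompleteSpace H]

theorem isCompactOperator_of_star_mul_self (S : H →L[ℂ] H)
    (h : IsCompactOperator (star S * S : H →L[ℂ] H)) : IsCompactOperator S := by
  rw [show (⇑S : H → H) = ⇑(S : H →ₗ[ℂ] H) from rfl,
    isCompactOperator_iff_isCompact_closure_image_closedBall (S : H →ₗ[ℂ] H) one_pos]
  have hK := (IsCompactOperator.isCompact_closure_image_closedBall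
    (f := ((star S * S : H →L[ℂ] H) : H →ₗ[ℂ] H)) h 1).totallyBounded.subset subset_closure
  refine TotallyBounded.isCompact_of_isClosed (TotallyBounded.closure ?_) isClosed_closure
  rw [Metric.totallyBounded_iff]
  intro ε hε
  obtain ⟨t, hts, htf, hcov⟩ := Metric.finite_approx_of_totallyBounded hK (ε ^ 2 / 2) (by positivity)
  have hts' : ∀ a ∈ t, ∃ v ∈ Metric.closedBall (0 : H) 1,
      ((star S * S : H →L[ℂ] H) : H →ₗ[ℂ] H) v = a := fun a ha => hts ha
  choose! g hg using hts'
  refine ⟨(fun y => S (g y)) '' t, htf.image _, ?_⟩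
  rintro _ ⟨x, hx, rfl⟩
  obtain ⟨y, hy, hxy⟩ := Set.mem_iUnion₂.1 (hcov ⟨x, hx, rfl⟩)
  refine Set.mem_iUnion₂.2 ⟨S (g y), ⟨y, hy, rfl⟩, ?_⟩
  obtain ⟨hgy, hgy'⟩ := hg y hy
  rw [← hgy'] at hxy
  simp only [Metric.mem_ball, dist_eq_norm, Metric.mem_closedBall, sub_zero] at hxy hx hgy ⊢
  have h1 : ‖S (x - g y)‖ ^ 2 ≤ ‖(star S * S : H →L[ℂ] H) (x - g y)‖ * ‖x - g y‖ := by
    have := ContinuousLinearMap.apply_norm_sq_eq_inner_adjoint_left S (x - g y)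
    rw [this]
    exact (RCLike.re_le_norm _).trans (norm_inner_le_norm _ _)
  have h2 : ‖x - g y‖ ≤ 2 := (norm_sub_le _ _).trans (by linarith)
  have h3 : ‖(star S * S : H →L[ℂ] H) (x - g y)‖ < ε ^ 2 / 2 := by
    rw [map_sub]; exact hxy
  have h4 : ‖S (x - g y)‖ ^ 2 < ε ^ 2 := by
    nlinarith [norm_nonneg ((star S * S : H →L[ℂ] H) (x - g y)), norm_nonneg (x - g y)]
  have := lt_of_pow_lt_pow_left₀ 2 hε.le h4
  rwa [map_sub] at this

variable (H) in
/-- The C⋆-algebra of all compact operators on the Hilbert space `H`, with the norm, the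
involution and the order (`a ≤ b` iff `b - a` is a positive operator) inherited from the
bounded operators. -/
def compactOperators : NonUnitalStarSubalgebra ℂ (H →L[ℂ] H) where
  carrier := {T | IsCompactOperator T}
  add_mem' ha hb := IsCompactOperator.add ha hb
  zero_mem' := isCompactOperator_zero
  mul_mem' {a b} ha _ := IsCompactOperator.comp_clm ha b
  smul_mem' c _ ha := IsCompactOperator.smul ha c
  star_mem' {a} ha := by
    refine isCompactOperator_of_star_mul_self _ ?_
    rw [star_star]
    exact IsCompactOperator.comp_clm ha (star a)

instance isClosed_compactOperators :
    IsClosed ((compactOperators H : NonUnitalStarSubalgebra ℂ (H →L[ℂ] H)) :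
      Set (H →L[ℂ] H)) :=
  isClosed_setOfPred_isCompactOperator

instance starOrderedRing_compactOperators : StarOrderedRing (compactOperators H) := by
  refine StarOrderedRing.of_nonneg_iff' (fun {x y} hxy z => ?_) (fun x => ⟨fun hx => ?_, ?_⟩)
  · have hxy' : (x : H →L[ℂ] H) ≤ y := hxy
    change ((z : H →L[ℂ] H) + x) ≤ z + y
    gcongr
  · have hx' : (0 : H →L[ℂ] H) ≤ x := hx
    obtain ⟨s, hs⟩ := CStarAlgebra.nonneg_iff_eq_star_mul_self.1 hx'
    refine ⟨⟨s, isCompactOperator_of_star_mul_self s ?_⟩, Subtype.ext hs⟩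
    rw [← hs]
    exact x.2
  · rintro ⟨s, rfl⟩
    change (0 : H →L[ℂ] H) ≤ star (s : H →L[ℂ] H) * s
    exact star_mul_self_nonneg _

end CompactOperators

namespace HilbertModule

/-! ### Compositions, ranges and kernels of partially defined operators -/

section PartialMaps

variable {E : Type*} [AddCommGroup E] [Module ℂ E]

/-- The composition `s t` with domain `{x ∈ Dom t | t x ∈ Dom s}`. -/
def pcomp (s t : E →ₗ.[ℂ] E) : E →ₗ.[ℂ] E :=
  s.comp (t.domRestrict ((s.domain.comap t.toFun).map t.domain.subtype)) (by
    rintro ⟨x, ⟨y, hy, rfl⟩, hx⟩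
    exact hy)

/-- The everywhere defined operator `T`, as a partially defined operator. -/
def everywhere (T : E →ₗ[ℂ] E) : E →ₗ.[ℂ] E := T.toPMap ⊤

def ran (t : E →ₗ.[ℂ] E) : Submodule ℂ E := LinearMap.range t.toFun

/-- `Ker t = {x ∈ Dom t | t x = 0}`. -/
def kernel (t : E →ₗ.[ℂ] E) : Submodule ℂ E := (LinearMap.ker t.toFun).map t.domain.subtype

end PartialMaps

/-! ### Operators on a Hilbert module

`CStarModule A E` is a left Hilbert `A`-module whose inner product `⟪x, y⟫_A` is `A`-linear in
the second variable.  The inner product `⟨x, y⟩` that is `A`-linear in the first variable is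
`⟪y, x⟫_A`. -/

section General

variable (A : Type*) {E : Type*} [NonUnitalCStarAlgebra A] [PartialOrder A]
  [NormedAddCommGroup E] [NormedSpace ℂ E] [SMul A E] [CStarModule A E]

variable {A} in
theorem ext_inner {u v : E} (h : ∀ w : E, ⟪w, u⟫_A = ⟪w, v⟫_A) : u = v := by
  rw [← sub_eq_zero, ← CStarModule.inner_self (A := A), CStarModule.inner_sub_right, h, sub_self]

theorem norm_smul_le' (a : A) (y : E) : ‖a • y‖ ≤ ‖a‖ * ‖y‖ := by
  have h : ‖a • y‖ ^ 2 ≤ (‖a‖ * ‖y‖) ^ 2 := by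
    rw [CStarModule.norm_sq_eq A, mul_pow, CStarModule.norm_sq_eq A (x := y)]
    simp only [CStarModule.inner_op_smul_right, CStarModule.inner_op_smul_left]
    calc ‖a * (⟪y, y⟫_A * star a)‖ ≤ ‖a‖ * (‖⟪y, y⟫_A‖ * ‖star a‖) :=
          (norm_mul_le _ _).trans (by gcongr; exact norm_mul_le _ _)
      _ = ‖a‖ ^ 2 * ‖⟪y, y⟫_A‖ := by rw [norm_star]; ring
  exact le_of_sq_le_sq h (by positivity)

variable [StarOrderedRing A]

/-- `Θ_{x,y} z = ⟨z, x⟩ y`. -/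
def theta (x y : E) : E →L[ℂ] E :=
  LinearMap.mkContinuous
    { toFun := fun z => ⟪x, z⟫_A • y
      map_add' := fun z w => ext_inner (A := A) fun v => by simp [add_mul]
      map_smul' := fun c z => ext_inner (A := A) fun v => by simp [smul_mul_assoc] }
    (‖x‖ * ‖y‖) (fun z => by
      refine (norm_smul_le' A _ _).trans ?_
      calc ‖⟪x, z⟫_A‖ * ‖y‖ ≤ (‖x‖ * ‖z‖) * ‖y‖ := by
            gcongr; exact CStarModule.norm_inner_le E
        _ = ‖x‖ * ‖y‖ * ‖z‖ := by ring)

variable (E) in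
/-- `K(E)`: the norm closure of the linear span of the operators `Θ_{x,y}`. -/
def moduleCompacts : Submodule ℂ (E →L[ℂ] E) :=
  (Submodule.span ℂ {T | ∃ x y : E, T = theta A x y}).topologicalClosure

/-- `T ∈ B(E)`: there is `S : E → E` with `⟨T x, y⟩ = ⟨x, S y⟩` for all `x, y`. -/
def IsAdjointable (T : E →L[ℂ] E) : Prop :=
  ∃ S : E → E, ∀ x y : E, ⟪y, T x⟫_A = ⟪S y, x⟫_A

/-- `Dom t` is a submodule of `E` and `t` is `A`-linear. -/
def IsModuleLinear (t : E →ₗ.[ℂ] E) : Prop :=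
  ∀ (a : A) (x : t.domain), ∃ h : a • (x : E) ∈ t.domain, t ⟨a • (x : E), h⟩ = a • t x

/-- All pairs `(y, y')` with `⟨t x, y⟩ = ⟨x, y'⟩` for all `x ∈ Dom t`. -/
def adjointGraph (t : E →ₗ.[ℂ] E) : Submodule ℂ (E × E) where
  carrier := {p | ∀ x : t.domain, ⟪p.1, t x⟫_A = ⟪p.2, (x : E)⟫_A}
  add_mem' {p q} hp hq x := by simp [hp x, hq x]
  zero_mem' x := by simp
  smul_mem' c p hp x := by simp [hp x]

/-- The adjoint `t⋆`: its domain consists of all `y` for which there is `y'` with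
`⟨t x, y⟩ = ⟨x, y'⟩` for all `x ∈ Dom t`, and `t⋆ y = y'`. This `y'` is unique when `Dom t` is
dense, see `adjointGraph_functional`. -/
def adjoint (t : E →ₗ.[ℂ] E) : E →ₗ.[ℂ] E := (adjointGraph A t).toLinearPMap

theorem adjointGraph_functional (t : E →ₗ.[ℂ] E) (ht : Dense (t.domain : Set E)) :
    ∀ p ∈ adjointGraph A t, p.1 = 0 → p.2 = 0 := by
  rintro ⟨y, y'⟩ hp (rfl : y = 0)
  have hc : Continuous fun x : E => ⟪y', x⟫_A :=
    CStarModule.continuous_inner.comp (Continuous.prodMk_right y')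
  have h0 : (fun x : E => ⟪y', x⟫_A) = fun _ => 0 :=
    Continuous.ext_on ht hc continuous_const fun x hx => by
      have := hp ⟨x, hx⟩
      simpa using this.symm
  exact CStarModule.inner_self.1 (congrFun h0 y')

theorem graph_adjoint (t : E →ₗ.[ℂ] E) (ht : Dense (t.domain : Set E)) :
    (adjoint A t).graph = adjointGraph A t :=
  Submodule.toLinearPMap_graph_eq _ fun p hp => adjointGraph_functional A t ht p hp

/-- Regular operators on `E`. -/
structure IsRegular (t : E →ₗ.[ℂ] E) : Prop where
  moduleLinear : IsModuleLinear A t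
  closed : t.IsClosed
  dense_domain : Dense (t.domain : Set E)
  dense_adjoint_domain : Dense ((adjoint A t).domain : Set E)
  dense_range_one_add :
    Dense (ran (everywhere LinearMap.id + pcomp (adjoint A t) t) : Set E)

/-- `s` is closable, its closure is an element of `B(E)`, and the closure is `1` modulo `K(E)`. -/
def ClosureIsOneModCompacts (s : E →ₗ.[ℂ] E) : Prop :=
  s.IsClosable ∧ ∃ T : E →L[ℂ] E, IsAdjointable A T ∧
    s.closure = everywhere (T : E →ₗ[ℂ] E) ∧ T - 1 ∈ moduleCompacts A E

/-- `G` is a pseudo left inverse of `t`. -/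
def IsPseudoLeftInverse (G : E →L[ℂ] E) (t : E →ₗ.[ℂ] E) : Prop :=
  IsAdjointable A G ∧ ClosureIsOneModCompacts A (pcomp (everywhere (G : E →ₗ[ℂ] E)) t)

/-- `G` is a pseudo right inverse of `t`. -/
def IsPseudoRightInverse (G : E →L[ℂ] E) (t : E →ₗ.[ℂ] E) : Prop :=
  IsAdjointable A G ∧ ClosureIsOneModCompacts A (pcomp t (everywhere (G : E →ₗ[ℂ] E)))

/-- A (regular) operator is Fredholm if it has a pseudo left and a pseudo right inverse. -/
def IsFredholm (t : E →ₗ.[ℂ] E) : Prop :=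
  (∃ G : E →L[ℂ] E, IsPseudoLeftInverse A G t) ∧ ∃ G : E →L[ℂ] E, IsPseudoRightInverse A G t

/-! ### Orthonormal bases and the orthonormal dimension -/

variable {A} in
/-- A minimal projection: a nonzero projection `e` with `e A e = ℂ e`. -/
def IsMinimalProjection (e : A) : Prop :=
  IsStarProjection e ∧ e ≠ 0 ∧ ∀ a : A, ∃ c : ℂ, e * a * e = c • e

/-- Every element is a basic vector, and different elements are orthogonal. -/
def IsOrthonormalSystem (B : Set E) : Prop :=
  (∀ x ∈ B, IsMinimalProjection ⟪x, x⟫_A) ∧ ∀ x ∈ B, ∀ y ∈ B, x ≠ y → ⟪y, x⟫_A = 0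

/-- The `A`-submodule generated by `B`. -/
def generatedSubmodule (B : Set E) : Submodule ℂ E :=
  Submodule.span ℂ (B ∪ {z | ∃ (a : A), ∃ x ∈ B, z = a • x})

/-- `B` is an orthonormal basis of the submodule `X` of `E`: an orthonormal system in `X` that
generates a dense submodule of `X`. -/
def IsOrthonormalBasis (B : Set E) (X : Submodule ℂ E) : Prop :=
  B ⊆ X ∧ IsOrthonormalSystem A B ∧ (X : Set E) ⊆ closure (generatedSubmodule A B : Set E)

/-- `dim X = κ`: the submodule `X` has an orthonormal basis of cardinality `κ`. -/
def HasOrthonormalDim (X : Submodule ℂ E) (κ : Cardinal) : Prop :=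
  ∃ B : Set E, IsOrthonormalBasis A B X ∧ Cardinal.mk B = κ

/-- `dim X` is finite. -/
def FiniteOrthonormalDim (X : Submodule ℂ E) : Prop :=
  ∃ n : ℕ, HasOrthonormalDim A X n

end General

end HilbertModule

end

/-!
Fix a unit vector `ξ` of `H` and let `e = |ξ⟩⟨ξ|`. On `e E` the module inner product is a complex
multiple of `e`, which makes `e E` a Hilbert space, and `E` is recovered from it: the slices
`|ξ⟩⟨η| x` of `x` lie in `e E`, and `x` is in the closed span of the vectors
`|η⟩⟨η| x = |η⟩⟨ξ| (|ξ⟩⟨η| x)`. In this way closed submodules of `E` inherit orthogonal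
projections and bounded module maps inherit adjoints, operators in `K(E)` compress to compact
operators on `e E`, and `dim X` is the Hilbert space dimension of `X ∩ e E`.

If `G t = 1 + k` with `k ∈ K(E)`, then `k = -1` on `Ker t`, so `e (Ker t)` is finite-dimensional,
and the usual compactness argument on `e E` bounds `t` below on `(Ker t)ᗮ`, so `Ran t` is closed. A
right pseudo-inverse bounds `dim (Ran t)ᗮ = dim Ker t⋆` in the same way. Conversely, the
Moore–Penrose inverse `G` of `t` satisfies `G t = 1 - p` and `t G = 1 - q` for the orthogonal
projections `p` onto `Ker t` and `q` onto `(Ran t)ᗮ`, and a projection onto a finite-dimensional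
submodule is the sum of the operators `Θ_{b,b}` over an orthonormal basis.
-/

noncomputable section

namespace HilbertModule

/-! ### Linear relations between Banach spaces -/

section LinearRelations

variable {𝕜 F G : Type*} [RCLike 𝕜] [NormedAddCommGroup F] [NormedSpace 𝕜 F]
  [NormedAddCommGroup G] [NormedSpace 𝕜 G] {Γ : Submodule 𝕜 (F × G)}

theorem isClosed_map_fst_of_norm_le [CompleteSpace F] [CompleteSpace G]
    (hΓ : IsClosed (Γ : Set (F × G))) {C : ℝ} (h : ∀ q ∈ Γ, ‖q.2‖ ≤ C * ‖q.1‖) :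
    IsClosed (Γ.map (LinearMap.fst 𝕜 F G) : Set F) := by
  have : CompleteSpace Γ := hΓ.completeSpace_coe
  let f : Γ →L[𝕜] F := ContinuousLinearMap.fst 𝕜 F G ∘L Γ.subtypeL
  have hf : AntilipschitzWith (Real.toNNReal (max 1 C)) f := by
    refine f.antilipschitz_of_bound fun q => ?_
    rw [Real.coe_toNNReal _ (zero_le_one.trans (le_max_left 1 C))]
    refine max_le (le_mul_of_one_le_left (norm_nonneg _) (le_max_left _ _)) ((h q q.2).trans ?_)
    exact mul_le_mul_of_nonneg_right (le_max_right _ _) (norm_nonneg _)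
  convert hf.isClosed_range f.uniformContinuous using 1
  ext y
  simp [f]

theorem exists_continuousLinearMap_of_isClosed [CompleteSpace F] [CompleteSpace G]
    (hΓ : IsClosed (Γ : Set (F × G))) (h0 : ∀ y, (0, y) ∈ Γ → y = 0)
    (htop : Γ.map (LinearMap.fst 𝕜 F G) = ⊤) :
    ∃ T : F →L[𝕜] G, ∀ x y, (x, y) ∈ Γ ↔ T x = y := by
  have : CompleteSpace Γ := hΓ.completeSpace_coe
  let f : Γ →L[𝕜] F := ContinuousLinearMap.fst 𝕜 F G ∘L Γ.subtypeL
  have hinj : LinearMap.ker (f : Γ →ₗ[𝕜] F) = ⊥ := by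
    refine LinearMap.ker_eq_bot'.2 ?_
    rintro ⟨⟨x, y⟩, hq⟩ (rfl : x = 0)
    exact Subtype.ext (Prod.ext rfl (h0 y hq))
  have hsurj : LinearMap.range (f : Γ →ₗ[𝕜] F) = ⊤ := by
    refine LinearMap.range_eq_top.2 fun x => ?_
    obtain ⟨q, hq, rfl⟩ := htop.ge (Submodule.mem_top (x := x))
    exact ⟨⟨q, hq⟩, rfl⟩
  let e := ContinuousLinearEquiv.ofBijective f hinj hsurj
  refine ⟨ContinuousLinearMap.snd 𝕜 F G ∘L Γ.subtypeL ∘L e.symm, fun x y => ⟨fun hxy => ?_, ?_⟩⟩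
  · have : e.symm x = ⟨(x, y), hxy⟩ := e.symm_apply_eq.2 rfl
    exact congrArg (fun q : Γ => (q : F × G).2) this
  · rintro rfl
    have : ((e.symm x : Γ) : F × G).1 = x := e.apply_symm_apply x
    convert (e.symm x).2 using 1
    exact Prod.ext this.symm rfl

theorem exists_norm_le_of_isCompactOperator (hΓ : IsClosed (Γ : Set (F × G)))
    (h0 : ∀ y, (0, y) ∈ Γ → y = 0) {S : F →L[𝕜] G} {k : G →L[𝕜] G} (hk : IsCompactOperator k)
    (h : ∀ q ∈ Γ, S q.1 = q.2 + k q.2) :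
    ∃ C : ℝ, 0 ≤ C ∧ ∀ q ∈ Γ, ‖q.2‖ ≤ C * ‖q.1‖ := by
  by_contra! hcon
  have hunit : ∀ n : ℕ, ∃ q ∈ Γ, ‖q.2‖ = 1 ∧ ‖q.1‖ ≤ 1 / ((n : ℝ) + 1) := by
    intro n
    obtain ⟨q, hq, hlt⟩ := hcon ((n : ℝ) + 1) (by positivity)
    have hpos : 0 < ‖q.2‖ := lt_of_le_of_lt (by positivity) hlt
    refine ⟨(‖q.2‖⁻¹ : 𝕜) • q, Γ.smul_mem _ hq, norm_smul_inv_norm (norm_pos_iff.1 hpos), ?_⟩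
    rw [Prod.smul_fst, norm_smul, norm_inv, RCLike.norm_ofReal, abs_norm, inv_mul_eq_div,
      div_le_div_iff₀ hpos (by positivity)]
    linarith
  choose q hq hq2 hq1 using hunit
  have hlim1 : Filter.Tendsto (fun n => (q n).1) Filter.atTop (nhds 0) :=
    squeeze_zero_norm hq1 tendsto_one_div_add_atTop_nhds_zero_nat
  obtain ⟨K, hK, hKs⟩ := hk.image_closedBall_subset_compact (f := (k : G →ₗ[𝕜] G)) 1
  obtain ⟨v, -, φ, hφ, hv⟩ := hK.tendsto_subseq (x := fun n => k (q n).2)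
    fun n => hKs ⟨(q n).2, by simp [hq2 n], rfl⟩
  have hlim1φ := hlim1.comp hφ.tendsto_atTop
  have hlim2 : Filter.Tendsto (fun n => (q (φ n)).2) Filter.atTop (nhds (-v)) := by
    have hS := (S.continuous.tendsto 0).comp hlim1φ
    rw [map_zero] at hS
    refine (zero_sub v ▸ hS.sub hv).congr fun n => ?_
    simp [h _ (hq (φ n))]
  have hmem : (0, -v) ∈ Γ := hΓ.mem_of_tendsto (hlim1φ.prodMk_nhds hlim2)
    (Filter.Eventually.of_forall fun n => hq (φ n))
  have hnorm : ‖-v‖ = 1 := tendsto_nhds_unique hlim2.norm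
    (tendsto_const_nhds.congr fun n => (hq2 (φ n)).symm)
  simp [h0 _ hmem] at hnorm

end LinearRelations

/-! ### The module action -/

section Stable

variable {A E : Type*} [AddCommGroup E] [Module ℂ E] [SMul A E]

variable (A) in
/-- The linear subspace `X` is stable under the action of `A`. Besides subspaces of a Hilbert
module `E` this is used for linear relations on `E`, that is, for subspaces of `E × E`. -/
def IsStable (X : Submodule ℂ E) : Prop := ∀ (a : A), ∀ x ∈ X, a • x ∈ X

end Stable

section ModuleAction

variable {A E : Type*} [NonUnitalCStarAlgebra A] [PartialOrder A]
  [NormedAddCommGroup E] [NormedSpace ℂ E] [SMul A E] [CStarModule A E]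

theorem mul_op_smul (a b : A) (x : E) : (a * b) • x = a • b • x :=
  ext_inner (A := A) fun w => by simp [mul_assoc]

theorem op_smul_add (a : A) (x y : E) : a • (x + y) = a • x + a • y :=
  ext_inner (A := A) fun w => by simp [mul_add]

theorem add_op_smul (a b : A) (x : E) : (a + b) • x = a • x + b • x :=
  ext_inner (A := A) fun w => by simp [add_mul]

theorem op_smul_smul (a : A) (c : ℂ) (x : E) : a • c • x = c • a • x :=
  ext_inner (A := A) fun w => by simp [mul_smul_comm]

theorem smul_op_smul (a : A) (c : ℂ) (x : E) : (c • a) • x = c • a • x :=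
  ext_inner (A := A) fun w => by simp [smul_mul_assoc]

variable (A E) in
/-- The module action `(a, x) ↦ a • x` as a bounded bilinear map. -/
def opSMulL : A →L[ℂ] E →L[ℂ] E :=
  LinearMap.mkContinuous₂ (LinearMap.mk₂ ℂ (fun (a : A) (x : E) => a • x)
    add_op_smul (fun c a x => smul_op_smul a c x) op_smul_add (fun c a x => op_smul_smul a c x)) 1
    (fun a x => by simpa using norm_smul_le' A a x)

theorem op_smul_zero (a : A) : a • (0 : E) = 0 := map_zero (opSMulL A E a)

theorem sum_op_smul {ι : Type*} (s : Finset ι) (a : ι → A) (x : E) :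
    (∑ i ∈ s, a i) • x = ∑ i ∈ s, a i • x := map_sum ((opSMulL A E).flip x) a s

theorem IsStable.topologicalClosure {X : Submodule ℂ E} (hX : IsStable A X) :
    IsStable A X.topologicalClosure := fun a _ hx =>
  map_mem_closure (opSMulL A E a).continuous hx fun y hy => hX a y hy

theorem isStable_generatedSubmodule (B : Set E) : IsStable A (generatedSubmodule A B) := by
  intro a
  suffices generatedSubmodule A B ≤
      (generatedSubmodule A B).comap (opSMulL A E a : E →ₗ[ℂ] E) from this
  refine Submodule.span_le.2 ?_
  rintro y (hy | ⟨b, z, hz, rfl⟩)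
  · exact Submodule.subset_span (Or.inr ⟨a, y, hy, rfl⟩)
  · exact Submodule.subset_span (Or.inr ⟨a * b, z, hz, (mul_op_smul a b z).symm⟩)

theorem inner_self_op_smul_self {x : E} (hx : IsMinimalProjection ⟪x, x⟫_A) :
    ⟪x, x⟫_A • x = x := by
  have h := hx.1.isIdempotentElem.eq
  rw [← sub_eq_zero, ← CStarModule.inner_self (A := A)]
  simp [h]

theorem IsAdjointable.map_op_smul {T : E →L[ℂ] E} (hT : IsAdjointable A T) (a : A) (x : E) :
    T (a • x) = a • T x := by
  obtain ⟨S, hS⟩ := hT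
  exact ext_inner (A := A) fun w => by simp [hS]

variable (A) in
theorem norm_le_of_norm_inner_self_le {x : E} {C : ℝ} (hC : 0 ≤ C) (h : ‖⟪x, x⟫_A‖ ≤ C * ‖x‖) :
    ‖x‖ ≤ C := by
  rw [← CStarModule.norm_sq_eq, sq] at h
  rcases (norm_nonneg x).eq_or_lt with h0 | h0
  · rwa [← h0]
  · exact le_of_mul_le_mul_right h h0

end ModuleAction

/-! ### Orthogonal complements and orthogonal projections -/

section Perp

variable {A E : Type*} [NonUnitalCStarAlgebra A] [PartialOrder A]
  [NormedAddCommGroup E] [NormedSpace ℂ E] [SMul A E] [CStarModule A E]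

variable (A) in
/-- The orthogonal complement of `X`. -/
def perp (X : Submodule ℂ E) : Submodule ℂ E where
  carrier := {y | ∀ x ∈ X, ⟪y, x⟫_A = 0}
  add_mem' hy hz x hx := by simp [hy x hx, hz x hx]
  zero_mem' x _ := by simp
  smul_mem' c y hy x hx := by simp [hy x hx]

theorem isStable_perp (X : Submodule ℂ E) : IsStable A (perp A X) := fun a y hy x hx => by
  simp [hy x hx]

theorem inner_eq_zero_of_mem_perp {X : Submodule ℂ E} {x y : E} (hx : x ∈ X) (hy : y ∈ perp A X) :
    ⟪x, y⟫_A = 0 := by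
  rw [← CStarModule.star_inner, hy x hx, star_zero]

theorem eq_zero_of_mem_of_mem_perp {X : Submodule ℂ E} {x : E} (hx : x ∈ X) (hx' : x ∈ perp A X) :
    x = 0 :=
  CStarModule.inner_self.1 (hx' x hx)

variable (A) in
/-- `p` is the orthogonal projection of `E` onto `X`. -/
structure IsOrthogonalProjection (X : Submodule ℂ E) (p : E →L[ℂ] E) : Prop where
  apply_mem (z : E) : p z ∈ X
  sub_apply_mem (z : E) : z - p z ∈ perp A X

namespace IsOrthogonalProjection

variable {X : Submodule ℂ E} {p p' : E →L[ℂ] E}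

theorem apply_eq_of (hp : IsOrthogonalProjection A X p) {x z : E} (hx : x ∈ X)
    (hxz : z - x ∈ perp A X) : p z = x := by
  refine sub_eq_zero.1 (eq_zero_of_mem_of_mem_perp (A := A)
    (X.sub_mem (hp.apply_mem z) hx) ?_)
  simpa using Submodule.sub_mem _ hxz (hp.sub_apply_mem z)

theorem apply_eq_self (hp : IsOrthogonalProjection A X p) {x : E} (hx : x ∈ X) : p x = x :=
  hp.apply_eq_of hx (by simp)

theorem unique (hp : IsOrthogonalProjection A X p) (hp' : IsOrthogonalProjection A X p') :
    p = p' :=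
  ContinuousLinearMap.ext fun z => hp.apply_eq_of (hp'.apply_mem z) (hp'.sub_apply_mem z)

theorem isAdjointable (hp : IsOrthogonalProjection A X p) : IsAdjointable A p := by
  refine ⟨p, fun x y => ?_⟩
  have h1 : ⟪y - p y, p x⟫_A = 0 := hp.sub_apply_mem y _ (hp.apply_mem x)
  have h2 : ⟪p y, x - p x⟫_A = 0 :=
    inner_eq_zero_of_mem_perp (hp.apply_mem y) (hp.sub_apply_mem x)
  rw [CStarModule.inner_sub_left, sub_eq_zero] at h1
  rw [CStarModule.inner_sub_right, sub_eq_zero] at h2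
  rw [h1, h2]

theorem one_sub (hp : IsOrthogonalProjection A X p) :
    IsOrthogonalProjection A (perp A X) (1 - p) where
  apply_mem := hp.sub_apply_mem
  sub_apply_mem z y hy := by
    simpa using inner_eq_zero_of_mem_perp (hp.apply_mem z) hy

end IsOrthogonalProjection

theorem finiteOrthonormalDim_iff {X : Submodule ℂ E} :
    FiniteOrthonormalDim A X ↔ ∃ B : Finset E, IsOrthonormalBasis A (B : Set E) X := by
  constructor
  · rintro ⟨n, B, hB, hn⟩
    have hfin : B.Finite := by
      rw [← Set.finite_coe_iff, ← Cardinal.lt_aleph0_iff_finite, hn]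
      exact Cardinal.natCast_lt_aleph0
    exact ⟨hfin.toFinset, by rwa [hfin.coe_toFinset]⟩
  · rintro ⟨B, hB⟩
    exact ⟨B.card, B, hB, Cardinal.mk_coe_finset⟩

variable [StarOrderedRing A]

theorem isClosed_perp (X : Submodule ℂ E) : IsClosed (perp A X : Set E) := by
  simp only [perp, Submodule.coe_set_mk, AddSubmonoid.coe_set_mk, AddSubsemigroup.coe_set_mk,
    Set.ofPred_forall]
  exact isClosed_biInter fun x _ => isClosed_eq
    (CStarModule.continuous_inner.comp (continuous_id.prodMk continuous_const)) continuous_const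

theorem inner_eq_zero_of_mem_closure {X : Submodule ℂ E} {x y : E} (hy : y ∈ perp A X)
    (hx : x ∈ closure (X : Set E)) : ⟪y, x⟫_A = 0 :=
  closure_minimal hy
    (isClosed_eq (CStarModule.innerSL (A := A) y).continuous continuous_const) hx

theorem mem_perp_generatedSubmodule {B : Set E} {y : E} (h : ∀ b ∈ B, ⟪y, b⟫_A = 0) :
    y ∈ perp A (generatedSubmodule A B) := by
  suffices generatedSubmodule A B ≤
    LinearMap.ker (CStarModule.innerSL (A := A) y : E →ₗ[ℂ] A) from this
  refine Submodule.span_le.2 ?_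
  rintro _ (hb | ⟨a, b, hb, rfl⟩)
  · exact h _ hb
  · change ⟪y, a • b⟫_A = 0
    simp [h b hb]

theorem isOrthogonalProjection_sum_theta {X : Submodule ℂ E} (hX : IsStable A X) {B : Finset E}
    (hB : IsOrthonormalBasis A (B : Set E) X) :
    IsOrthogonalProjection A X (∑ b ∈ B, theta A b b) := by
  obtain ⟨hBX, ⟨hB1, hB0⟩, hgen⟩ := hB
  have happly : ∀ z, (∑ b ∈ B, theta A b b) z = ∑ b ∈ B, ⟪b, z⟫_A • b := fun z =>
    sum_apply _ _ _
  refine ⟨fun z => ?_, fun z x hx => inner_eq_zero_of_mem_closure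
    (mem_perp_generatedSubmodule fun b hb => ?_) (hgen hx)⟩
  · rw [happly]
    exact Submodule.sum_mem _ fun b hb => hX _ _ (hBX hb)
  · have hterm : ⟪⟪b, z⟫_A • b, b⟫_A = ⟪z, b⟫_A := by
      conv_rhs => rw [← inner_self_op_smul_self (hB1 b hb)]
      simp
    rw [happly, CStarModule.inner_sub_left, CStarModule.inner_sum_left, Finset.sum_eq_single b,
      hterm, sub_self]
    · intro c hc hcb
      rw [CStarModule.inner_op_smul_left, hB0 b hb c hc hcb.symm, zero_mul]
    · exact fun h => absurd hb h

theorem IsOrthogonalProjection.mem_moduleCompacts {X : Submodule ℂ E} {p : E →L[ℂ] E}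
    (hp : IsOrthogonalProjection A X p) (hX : IsStable A X) (hd : FiniteOrthonormalDim A X) :
    p ∈ moduleCompacts A E := by
  obtain ⟨B, hB⟩ := finiteOrthonormalDim_iff.1 hd
  rw [hp.unique (isOrthogonalProjection_sum_theta hX hB)]
  exact Submodule.le_topologicalClosure _
    (Submodule.sum_mem _ fun b _ => Submodule.subset_span ⟨b, b, rfl⟩)

end Perp

/-! ### Partially defined operators and their graphs -/

section PartialMapGraphs

variable {E : Type*} [AddCommGroup E] [Module ℂ E]

theorem mem_graph_everywhere {T : E →ₗ[ℂ] E} {x z : E} :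
    (x, z) ∈ (everywhere T).graph ↔ T x = z := by
  simp [everywhere, LinearPMap.mem_graph_iff]

theorem mem_graph_pcomp {s t : E →ₗ.[ℂ] E} {x z : E} :
    (x, z) ∈ (pcomp s t).graph ↔ ∃ y, (x, y) ∈ t.graph ∧ (y, z) ∈ s.graph := by
  constructor
  · intro h
    obtain ⟨⟨x', ⟨_, hx⟩⟩, hx', hz⟩ := (LinearPMap.mem_graph_iff _).1 h
    obtain rfl : x' = x := hx'
    exact ⟨t ⟨x', hx⟩, t.mem_graph ⟨x', hx⟩, (LinearPMap.mem_graph_iff _).2 ⟨_, rfl, hz⟩⟩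
  · rintro ⟨y, hxy, hyz⟩
    obtain ⟨x', rfl, rfl⟩ := (LinearPMap.mem_graph_iff _).1 hxy
    obtain ⟨y', hy', rfl⟩ := (LinearPMap.mem_graph_iff _).1 hyz
    have hmem : t x' ∈ s.domain := by rw [← show (y' : E) = t x' from hy']; exact y'.2
    refine (LinearPMap.mem_graph_iff _).2 ⟨⟨x', ⟨x', hmem, rfl⟩, x'.2⟩, rfl, ?_⟩
    exact congrArg s (Subtype.ext hy'.symm)

theorem mem_kernel {t : E →ₗ.[ℂ] E} {x : E} : x ∈ kernel t ↔ (x, 0) ∈ t.graph := by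
  simp [kernel]

theorem mem_ran {t : E →ₗ.[ℂ] E} {z : E} : z ∈ ran t ↔ ∃ x, (x, z) ∈ t.graph :=
  (LinearPMap.mem_range_iff (f := t)).trans Iff.rfl

end PartialMapGraphs

section ClosedOperators

variable {E : Type*} [NormedAddCommGroup E] [NormedSpace ℂ E]

theorem IsModuleLinear.isStable_graph {A : Type*} [SMul A E] {t : E →ₗ.[ℂ] E}
    (ht : IsModuleLinear A t) : IsStable A t.graph := by
  rintro a ⟨x, z⟩ hxz
  obtain ⟨x', rfl, rfl⟩ := (LinearPMap.mem_graph_iff _).1 hxz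
  obtain ⟨h, h'⟩ := ht a x'
  exact (LinearPMap.mem_graph_iff _).2 ⟨⟨_, h⟩, rfl, h'⟩

theorem IsModuleLinear.isStable_ran {A : Type*} [SMul A E] {t : E →ₗ.[ℂ] E}
    (ht : IsModuleLinear A t) : IsStable A (ran t) := fun a _ hz => by
  obtain ⟨x, hx⟩ := mem_ran.1 hz
  exact mem_ran.2 ⟨a • x, ht.isStable_graph a _ hx⟩

theorem isClosed_kernel {t : E →ₗ.[ℂ] E} (hc : t.IsClosed) : IsClosed (kernel t : Set E) := by
  have : (kernel t : Set E) = (fun x => (x, 0)) ⁻¹' (t.graph : Set (E × E)) :=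
    Set.ext fun x => mem_kernel
  rw [this]
  exact hc.preimage (Continuous.prodMk_left 0)

theorem isClosed_everywhere (T : E →L[ℂ] E) : (everywhere (T : E →ₗ[ℂ] E)).IsClosed := by
  have : ((everywhere (T : E →ₗ[ℂ] E)).graph : Set (E × E)) = {q | T q.1 = q.2} :=
    Set.ext fun ⟨x, z⟩ => mem_graph_everywhere
  rw [LinearPMap.IsClosed, this]
  exact isClosed_eq (T.continuous.comp continuous_fst) continuous_snd

theorem isClosable_and_closure_eq_everywhere {s : E →ₗ.[ℂ] E} {T : E →L[ℂ] E}
    (hd : Dense (s.domain : Set E)) (h : ∀ x : s.domain, s x = T x) :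
    s.IsClosable ∧ s.closure = everywhere (T : E →ₗ[ℂ] E) := by
  have hle : s ≤ everywhere (T : E →ₗ[ℂ] E) := by
    refine LinearPMap.le_of_le_graph ?_
    rintro ⟨x, z⟩ hxz
    obtain ⟨x', rfl, rfl⟩ := (LinearPMap.mem_graph_iff _).1 hxz
    exact mem_graph_everywhere.2 (h x').symm
  have hcl : s.IsClosable := (isClosed_everywhere T).isClosable.leIsClosable hle
  refine ⟨hcl, LinearPMap.eq_of_eq_graph ?_⟩
  rw [← hcl.graph_closure_eq_closure_graph]
  refine le_antisymm
    (Submodule.topologicalClosure_minimal _ (LinearPMap.le_graph_of_le hle)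
      (isClosed_everywhere T)) ?_
  rintro ⟨x, z⟩ hxz
  obtain rfl : T x = z := mem_graph_everywhere.1 hxz
  have hcont : Continuous fun x => (x, T x) := continuous_id.prodMk T.continuous
  refine map_mem_closure (f := fun x => (x, T x)) hcont (hd x) fun y hy => ?_
  have := s.mem_graph ⟨y, hy⟩
  rwa [h] at this

end ClosedOperators

section Adjoint

variable {A E : Type*} [NonUnitalCStarAlgebra A] [PartialOrder A]
  [NormedAddCommGroup E] [NormedSpace ℂ E] [SMul A E] [CStarModule A E]

theorem IsModuleLinear.isStable_kernel {t : E →ₗ.[ℂ] E} (ht : IsModuleLinear A t) :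
    IsStable A (kernel t) := fun a x hx => by
  have h := ht.isStable_graph a _ (mem_kernel.1 hx)
  rw [Prod.smul_mk, op_smul_zero] at h
  exact mem_kernel.2 h

variable [StarOrderedRing A]

theorem isClosed_adjointGraph (t : E →ₗ.[ℂ] E) : IsClosed (adjointGraph A t : Set (E × E)) := by
  simp only [adjointGraph, Submodule.coe_set_mk, AddSubmonoid.coe_set_mk,
    AddSubsemigroup.coe_set_mk, Set.ofPred_forall]
  exact isClosed_iInter fun x => isClosed_eq
    (CStarModule.continuous_inner.comp (continuous_fst.prodMk continuous_const))
    (CStarModule.continuous_inner.comp (continuous_snd.prodMk continuous_const))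

theorem kernel_adjoint {t : E →ₗ.[ℂ] E} (ht : Dense (t.domain : Set E)) :
    kernel (adjoint A t) = perp A (ran t) := by
  ext y
  rw [mem_kernel, graph_adjoint A t ht]
  constructor
  · rintro hy _ ⟨x, rfl⟩
    exact (hy x).trans (by simp)
  · intro hy x
    exact (hy _ ⟨x, rfl⟩).trans (by simp)

end Adjoint

/-! ### Pseudo-inverses -/

section PseudoInverse

variable {A E : Type*} [NonUnitalCStarAlgebra A] [PartialOrder A] [StarOrderedRing A]
  [NormedAddCommGroup E] [NormedSpace ℂ E] [SMul A E] [CStarModule A E]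
  {t : E →ₗ.[ℂ] E} {G p : E →L[ℂ] E}

theorem IsPseudoLeftInverse.exists_apply_eq_add (hG : IsPseudoLeftInverse A G t) :
    ∃ k ∈ moduleCompacts A E, ∀ x z, (x, z) ∈ t.graph → G z = x + k x := by
  obtain ⟨-, -, T, -, hT, hTK⟩ := hG
  refine ⟨T - 1, hTK, fun x z hxz => ?_⟩
  have h1 : (x, G z) ∈ (pcomp (everywhere (G : E →ₗ[ℂ] E)) t).graph :=
    mem_graph_pcomp.2 ⟨z, hxz, mem_graph_everywhere.2 rfl⟩
  have h2 := LinearPMap.le_graph_of_le (LinearPMap.le_closure _) h1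
  rw [hT] at h2
  have h3 : T x = G z := mem_graph_everywhere.1 h2
  simp [h3]

theorem IsPseudoRightInverse.exists_add_mem_closure_ran (hG : IsPseudoRightInverse A G t) :
    ∃ k ∈ moduleCompacts A E, ∀ x, x + k x ∈ closure (ran t : Set E) := by
  obtain ⟨-, hcl, T, -, hT, hTK⟩ := hG
  refine ⟨T - 1, hTK, fun x => ?_⟩
  have h1 : (x, T x) ∈ (pcomp t (everywhere (G : E →ₗ[ℂ] E))).closure.graph := by
    rw [hT]
    exact mem_graph_everywhere.2 rfl
  rw [← hcl.graph_closure_eq_closure_graph] at h1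
  have h2 : T x ∈ closure (ran t : Set E) := by
    refine map_mem_closure (f := Prod.snd) continuous_snd h1 ?_
    rintro ⟨y, z⟩ hyz
    obtain ⟨w, -, hw⟩ := mem_graph_pcomp.1 hyz
    exact mem_ran.2 ⟨w, hw⟩
  simpa using h2

theorem closureIsOneModCompacts_of_eq_sub {s : E →ₗ.[ℂ] E} (hd : Dense (s.domain : Set E))
    (hpa : IsAdjointable A p) (hp : p ∈ moduleCompacts A E) (h : ∀ x : s.domain, s x = x - p x) :
    ClosureIsOneModCompacts A s := by
  obtain ⟨S, hS⟩ := hpa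
  obtain ⟨hcl, hcl'⟩ := isClosable_and_closure_eq_everywhere (T := 1 - p) hd h
  refine ⟨hcl, 1 - p, ⟨fun y => y - S y, fun x y => by simp [hS]⟩, hcl', ?_⟩
  rw [sub_sub_cancel_left]
  exact neg_mem hp

theorem isPseudoLeftInverse_of_apply_eq_sub (hd : Dense (t.domain : Set E))
    (hG : IsAdjointable A G) (hpa : IsAdjointable A p) (hp : p ∈ moduleCompacts A E)
    (h : ∀ x z, (x, z) ∈ t.graph → G z = x - p x) : IsPseudoLeftInverse A G t := by
  refine ⟨hG, closureIsOneModCompacts_of_eq_sub (hd.mono fun x hx => ?_) hpa hp fun x => ?_⟩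
  · exact LinearPMap.mem_domain_iff.2
      ⟨_, mem_graph_pcomp.2 ⟨_, t.mem_graph ⟨x, hx⟩, mem_graph_everywhere.2 rfl⟩⟩
  · obtain ⟨z, hz, hGz⟩ := mem_graph_pcomp.1 (LinearPMap.mem_graph _ x)
    exact (mem_graph_everywhere.1 hGz).symm.trans (h _ _ hz)

theorem isPseudoRightInverse_of_mem_graph (hG : IsAdjointable A G) (hpa : IsAdjointable A p)
    (hp : p ∈ moduleCompacts A E) (h : ∀ y, (G y, y - p y) ∈ t.graph) :
    IsPseudoRightInverse A G t := by
  refine ⟨hG, closureIsOneModCompacts_of_eq_sub ?_ hpa hp fun x => ?_⟩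
  · refine dense_univ.mono fun y _ => LinearPMap.mem_domain_iff.2 ⟨y - p y, ?_⟩
    exact mem_graph_pcomp.2 ⟨G y, mem_graph_everywhere.2 rfl, h y⟩
  · obtain ⟨y, hy, hyz⟩ := mem_graph_pcomp.1 (LinearPMap.mem_graph _ x)
    obtain rfl : G x = y := mem_graph_everywhere.1 hy
    exact LinearPMap.mem_graph_snd_inj t hyz (h x) rfl

end PseudoInverse

/-! ### The Moore–Penrose inverse -/

section MoorePenrose

variable {A E : Type*} [NonUnitalCStarAlgebra A] [PartialOrder A]
  [NormedAddCommGroup E] [NormedSpace ℂ E] [SMul A E] [CStarModule A E]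
  {t : E →ₗ.[ℂ] E} {p q : E →L[ℂ] E}

variable (A t) in
/-- The graph `{(t x, x) | x ∈ Dom t, x ⊥ Ker t}` of the Moore–Penrose inverse of `t`. -/
def moorePenroseGraph : Submodule ℂ (E × E) :=
  t.graph.comap (LinearEquiv.prodComm ℂ E E : E × E →ₗ[ℂ] E × E) ⊓
    (perp A (kernel t)).comap (LinearMap.snd ℂ E E)

theorem isStable_moorePenroseGraph (ht : IsModuleLinear A t) : IsStable A (moorePenroseGraph A t) :=
  fun a _ hq => ⟨ht.isStable_graph a _ hq.1, isStable_perp _ a _ hq.2⟩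

theorem eq_zero_of_zero_mem_moorePenroseGraph {x : E} (hx : (0, x) ∈ moorePenroseGraph A t) :
    x = 0 :=
  eq_zero_of_mem_of_mem_perp (mem_kernel.2 hx.1) hx.2

theorem sub_mem_moorePenroseGraph (hp : IsOrthogonalProjection A (kernel t) p) {x z : E}
    (hxz : (x, z) ∈ t.graph) : (z, x - p x) ∈ moorePenroseGraph A t := by
  refine ⟨?_, hp.sub_apply_mem x⟩
  simpa using t.graph.sub_mem hxz (mem_kernel.1 (hp.apply_mem x))

theorem map_fst_moorePenroseGraph (hp : IsOrthogonalProjection A (kernel t) p) :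
    (moorePenroseGraph A t).map (LinearMap.fst ℂ E E) = ran t := by
  ext z
  rw [mem_ran]
  constructor
  · rintro ⟨q, hq, rfl⟩
    exact ⟨q.2, hq.1⟩
  · rintro ⟨x, hx⟩
    exact ⟨_, sub_mem_moorePenroseGraph hp hx, rfl⟩

variable [StarOrderedRing A]

theorem isClosed_moorePenroseGraph (hc : t.IsClosed) :
    IsClosed (moorePenroseGraph A t : Set (E × E)) :=
  (hc.preimage continuous_swap).inter ((isClosed_perp _).preimage continuous_snd)

theorem exists_moorePenroseInverse [CompleteSpace E] (ht : IsModuleLinear A t) (hc : t.IsClosed)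
    (hp : IsOrthogonalProjection A (kernel t) p) (hq : IsOrthogonalProjection A (ran t) q) :
    ∃ G : E →L[ℂ] E, (∀ (a : A) (y : E), G (a • y) = a • G y) ∧
      (∀ x z, (x, z) ∈ t.graph → G z = x - p x) ∧ ∀ y, (G y, q y) ∈ t.graph := by
  let Γ : Submodule ℂ (E × E) := (moorePenroseGraph A t).comap
    ((q : E →ₗ[ℂ] E).prodMap LinearMap.id)
  have hΓ : IsClosed (Γ : Set (E × E)) := (isClosed_moorePenroseGraph hc).preimage
    ((q.continuous.comp continuous_fst).prodMk continuous_snd)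
  obtain ⟨G, hG⟩ := exists_continuousLinearMap_of_isClosed hΓ
    (fun x hx => eq_zero_of_zero_mem_moorePenroseGraph (by simpa [Γ] using hx))
    (eq_top_iff.2 fun y _ => by
      obtain ⟨w, hw, hwy⟩ := (map_fst_moorePenroseGraph hp).ge (hq.apply_mem y)
      have hyw : (q y, w.2) ∈ moorePenroseGraph A t := by
        rw [← hwy]
        exact hw
      exact ⟨(y, w.2), hyw, rfl⟩)
  have hmem : ∀ y, (q y, G y) ∈ moorePenroseGraph A t := fun y => (hG y _).2 rfl
  refine ⟨G, fun a y => (hG _ _).1 ?_, fun x z hxz => (hG _ _).1 ?_, fun y => (hmem y).1⟩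
  · change (q (a • y), a • G y) ∈ moorePenroseGraph A t
    rw [hq.isAdjointable.map_op_smul]
    exact isStable_moorePenroseGraph ht a _ (hmem y)
  · change (q z, x - p x) ∈ moorePenroseGraph A t
    rw [hq.apply_eq_self (mem_ran.2 ⟨x, hxz⟩)]
    exact sub_mem_moorePenroseGraph hp hxz

end MoorePenrose

/-! ### Rank one operators and slices -/

section RankOne

variable {H : Type*} [NormedAddCommGroup H] [InnerProductSpace ℂ H] [CompleteSpace H]

/-- The rank one operator `|η⟩⟨ζ|`, as an element of the algebra of compact operators. -/
def ketBra (η ζ : H) : compactOperators H :=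
  ⟨InnerProductSpace.rankOne ℂ η ζ,
    (isCompactOperator_of_locallyCompactSpace_dom (innerSL ℂ ζ)).clm_comp
      (ContinuousLinearMap.toSpanSingleton ℂ η)⟩

@[simp]
theorem coe_ketBra (η ζ : H) : (ketBra η ζ : H →L[ℂ] H) = InnerProductSpace.rankOne ℂ η ζ := rfl

theorem ketBra_mul_mul_ketBra (α β γ δ : H) (a : compactOperators H) :
    ketBra α β * a * ketBra γ δ = ⟪β, (a : H →L[ℂ] H) γ⟫_ℂ • ketBra α δ := by
  ext v
  simp [smul_smul, mul_comm]

theorem ketBra_mul_ketBra (α β γ δ : H) : ketBra α β * ketBra γ δ = ⟪β, γ⟫_ℂ • ketBra α δ := by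
  ext v
  simp [smul_smul, mul_comm]

@[simp]
theorem star_ketBra (η ζ : H) : star (ketBra η ζ) = ketBra ζ η :=
  Subtype.ext (by simp [ContinuousLinearMap.star_eq_adjoint])

theorem norm_ketBra (η ζ : H) : ‖ketBra η ζ‖ = ‖η‖ * ‖ζ‖ :=
  InnerProductSpace.norm_rankOne η ζ

theorem eq_zero_of_forall_ketBra_mul_eq_zero {ξ : H} (hξ : ξ ≠ 0) {a : compactOperators H}
    (h : ∀ η, ketBra ξ η * a = 0) : a = 0 := by
  ext v
  have h1 : (ketBra ξ ((a : H →L[ℂ] H) v) * a : compactOperators H).1 v = 0 := by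
    rw [h]
    rfl
  simpa [hξ] using h1

theorem isMinimalProjection_ketBra (ξ : Metric.sphere (0 : H) 1) :
    IsMinimalProjection (ketBra (ξ : H) ξ) := by
  refine ⟨⟨?_, star_ketBra _ _⟩, ?_, fun a => ⟨_, ketBra_mul_mul_ketBra _ _ _ _ a⟩⟩
  · simp [IsIdempotentElem, ketBra_mul_ketBra]
  · rw [← norm_ne_zero_iff, norm_ketBra]
    simp

theorem exists_finiteDimensional_norm_sub_starProjection_mul_le (a : compactOperators H) {ε : ℝ}
    (hε : 0 < ε) : ∃ U : Submodule ℂ H, ∃ _ : FiniteDimensional ℂ U,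
      ‖(a : H →L[ℂ] H) - U.starProjection * a‖ ≤ ε := by
  have hK := (IsCompactOperator.isCompact_closure_image_closedBall
    (f := ((a : H →L[ℂ] H) : H →ₗ[ℂ] H)) a.2 1).totallyBounded.subset subset_closure
  obtain ⟨s, hs, hcov⟩ := Metric.totallyBounded_iff.1 hK ε hε
  have : FiniteDimensional ℂ (Submodule.span ℂ s) := FiniteDimensional.span_of_finite ℂ hs
  refine ⟨Submodule.span ℂ s, this, ContinuousLinearMap.opNorm_le_of_unit_norm hε.le ?_⟩
  intro u hu
  obtain ⟨y, hy, huy⟩ := Set.mem_iUnion₂.1 (hcov ⟨u, by simp [hu], rfl⟩)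
  have hy' : (Submodule.span ℂ s).starProjection y = y :=
    Submodule.starProjection_eq_self_iff.2 (Submodule.subset_span hy)
  have hsub : ((a : H →L[ℂ] H) - (Submodule.span ℂ s).starProjection * a) u =
      (Submodule.span ℂ s)ᗮ.starProjection ((a : H →L[ℂ] H) u - y) := by
    rw [Submodule.starProjection_orthogonal]
    simp [hy']
  rw [hsub]
  exact (Submodule.norm_starProjection_apply_le _ _).trans (mem_ball_iff_norm.1 huy).le

end RankOne

section Slices

variable {H : Type*} [NormedAddCommGroup H] [InnerProductSpace ℂ H] [CompleteSpace H]
  {E : Type*} [NormedAddCommGroup E] [NormedSpace ℂ E]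
  [SMul (compactOperators H) E] [CStarModule (compactOperators H) E]

theorem mem_closure_span_ketBra_smul (x : E) :
    x ∈ closure (Submodule.span ℂ
      (Set.range fun η : Metric.sphere (0 : H) 1 => ketBra (η : H) η • x) : Set E) := by
  refine Metric.mem_closure_iff.2 fun ε hε => ?_
  obtain ⟨U, hU, hUε⟩ := exists_finiteDimensional_norm_sub_starProjection_mul_le
    (⟪x, x⟫_(compactOperators H)) (show 0 < ε ^ 2 / 2 by positivity)
  let b := stdOrthonormalBasis ℂ U
  have hb : ∀ i, ‖(b i : H)‖ = 1 := b.orthonormal.1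
  let p : compactOperators H := ∑ i, ketBra (b i : H) (b i : H)
  have hp : (p : H →L[ℂ] H) = U.starProjection := by
    rw [b.starProjection_eq_sum_rankOne]
    simp [p]
  have hps : star p = p := by simp [p]
  have hinner : (⟪x - p • x, x - p • x⟫_(compactOperators H) : H →L[ℂ] H) =
      ((⟪x, x⟫_(compactOperators H) : H →L[ℂ] H) -
        U.starProjection * (⟪x, x⟫_(compactOperators H) : H →L[ℂ] H)) * Uᗮ.starProjection := by
    simp only [CStarModule.inner_sub_left, CStarModule.inner_sub_right,
      CStarModule.inner_op_smul_left, CStarModule.inner_op_smul_right, hps,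
      AddSubgroupClass.coe_sub, MulMemClass.coe_mul, hp, Submodule.starProjection_orthogonal',
      mul_sub, sub_mul, mul_assoc, mul_one]
    abel
  refine ⟨p • x, ?_, ?_⟩
  · simp only [p, sum_op_smul]
    exact Submodule.sum_mem _ fun i _ =>
      Submodule.subset_span ⟨⟨b i, mem_sphere_zero_iff_norm.2 (hb i)⟩, rfl⟩
  · rw [dist_eq_norm]
    refine lt_of_pow_lt_pow_left₀ 2 hε.le ?_
    calc ‖x - p • x‖ ^ 2
        = ‖(⟪x - p • x, x - p • x⟫_(compactOperators H) : H →L[ℂ] H)‖ :=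
          CStarModule.norm_sq_eq (compactOperators H)
      _ ≤ ε ^ 2 / 2 * 1 := hinner ▸ (norm_mul_le _ _).trans
          (mul_le_mul hUε (Submodule.starProjection_norm_le _) (norm_nonneg _) (by positivity))
      _ < ε ^ 2 := by nlinarith

theorem mem_of_forall_ketBra_smul_mem {X : Submodule ℂ E} (hc : IsClosed (X : Set E)) {x : E}
    (h : ∀ η : Metric.sphere (0 : H) 1, ketBra (η : H) η • x ∈ X) : x ∈ X := by
  refine closure_minimal ?_ hc (mem_closure_span_ketBra_smul (H := H) x)
  exact Submodule.span_le.2 (Set.range_subset_iff.2 h)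

theorem ketBra_smul_ketBra_smul (ξ : Metric.sphere (0 : H) 1) (η ζ : H) (x : E) :
    ketBra η (ξ : H) • ketBra (ξ : H) ζ • x = ketBra η ζ • x := by
  rw [← mul_op_smul, ketBra_mul_ketBra]
  simp

variable (H E) in
theorem subsingleton_or_nonempty_sphere :
    Subsingleton E ∨ Nonempty (Metric.sphere (0 : H) 1) := by
  rcases subsingleton_or_nontrivial H with hH | hH
  · exact Or.inl (subsingleton_of_forall_eq 0 fun x =>
      CStarModule.inner_self.1 (Subsingleton.elim (⟪x, x⟫_(compactOperators H)) 0))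
  · exact Or.inr (NormedSpace.sphere_nonempty.2 zero_le_one).to_subtype

end Slices

/-! ### The Hilbert space `e E` of a rank one projection `e` -/

section Corner

variable {H : Type*} [NormedAddCommGroup H] [InnerProductSpace ℂ H] [CompleteSpace H]
  {E : Type*} [NormedAddCommGroup E] [NormedSpace ℂ E]
  [SMul (compactOperators H) E] [CStarModule (compactOperators H) E]
  (ξ : Metric.sphere (0 : H) 1)

variable (E) in
/-- The subspace `e E` of `E`, where `e` is the minimal projection `|ξ⟩⟨ξ|`. -/
def corner : Submodule ℂ E :=
  LinearMap.eqLocus (opSMulL (compactOperators H) E (ketBra ξ ξ) : E →ₗ[ℂ] E) LinearMap.id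

theorem mem_corner {x : E} : x ∈ corner E ξ ↔ ketBra (ξ : H) ξ • x = x := Iff.rfl

theorem ketBra_smul_mem_corner (η : H) (x : E) : ketBra (ξ : H) η • x ∈ corner E ξ :=
  ketBra_smul_ketBra_smul ξ ξ η x

theorem isClosed_corner : IsClosed (corner E ξ : Set E) :=
  isClosed_eq (opSMulL (compactOperators H) E (ketBra ξ ξ)).continuous continuous_id

instance [CompleteSpace E] : CompleteSpace (corner E ξ) :=
  (isClosed_corner ξ).completeSpace_coe

theorem ketBra_mul_inner (x : E) (y : corner E ξ) :
    ketBra (ξ : H) ξ * ⟪x, (y : E)⟫_(compactOperators H) = ⟪x, (y : E)⟫_(compactOperators H) := by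
  rw [← CStarModule.inner_op_smul_right, (mem_corner ξ).1 y.2]

instance : Inner ℂ (corner E ξ) where
  inner x y := ⟪(ξ : H), (⟪(x : E), (y : E)⟫_(compactOperators H) : H →L[ℂ] H) ξ⟫_ℂ

theorem inner_corner_def (x y : corner E ξ) :
    ⟪x, y⟫_ℂ = ⟪(ξ : H), (⟪(x : E), (y : E)⟫_(compactOperators H) : H →L[ℂ] H) ξ⟫_ℂ := rfl

theorem inner_corner_eq_smul (x y : corner E ξ) :
    ⟪(x : E), (y : E)⟫_(compactOperators H) = ⟪x, y⟫_ℂ • ketBra (ξ : H) ξ := by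
  refine Eq.trans ?_ (ketBra_mul_mul_ketBra _ _ _ _ _)
  rw [ketBra_mul_inner, ← star_ketBra, ← CStarModule.inner_op_smul_left, (mem_corner ξ).1 x.2]

instance : InnerProductSpace ℂ (corner E ξ) where
  norm_sq_eq_re_inner x := by
    have hpos : (0 : H →L[ℂ] H) ≤ (⟪(x : E), (x : E)⟫_(compactOperators H) : H →L[ℂ] H) :=
      CStarModule.inner_self_nonneg (A := compactOperators H) (x := (x : E))
    have hinner := ((ContinuousLinearMap.nonneg_iff_isPositive _).1 hpos).inner_nonneg_right (ξ : H)
    rw [← inner_corner_def] at hinner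
    have hnorm : ‖(x : E)‖ ^ 2 = ‖⟪x, x⟫_ℂ‖ := by
      rw [CStarModule.norm_sq_eq (compactOperators H), inner_corner_eq_smul, norm_smul, norm_ketBra]
      simp
    rw [Submodule.coe_norm, hnorm]
    simpa using congrArg Complex.re (Complex.norm_of_nonneg' hinner)
  conj_inner_symm x y := by
    rw [inner_corner_def, inner_corner_def, ← CStarModule.star_inner (y : E) (x : E),
      inner_conj_symm]
    exact (ContinuousLinearMap.adjoint_inner_right _ _ _).symm
  add_left x y z := by simp [inner_corner_def]
  smul_left x y r := by simp [inner_corner_def]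

/-- The map `x ↦ |ξ⟩⟨η| x` from `E` to `e E`. -/
def slice (η : H) : E →L[ℂ] corner E ξ :=
  (opSMulL (compactOperators H) E (ketBra ξ η)).codRestrict _ (ketBra_smul_mem_corner ξ η)

@[simp]
theorem coe_slice (η : H) (x : E) : (slice ξ η x : E) = ketBra (ξ : H) η • x := rfl

theorem slice_coe (x : corner E ξ) : slice ξ (ξ : H) (x : E) = x :=
  Subtype.ext x.2

theorem inner_slice_eq_zero {x : E} {y : corner E ξ}
    (h : ⟪(y : E), x⟫_(compactOperators H) = 0) (η : H) : ⟪y, slice ξ η x⟫_ℂ = 0 := by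
  have hsmul := inner_corner_eq_smul ξ y (slice ξ η x)
  rw [coe_slice, CStarModule.inner_op_smul_right, h, mul_zero] at hsmul
  exact (smul_eq_zero.1 hsmul.symm).resolve_right (isMinimalProjection_ketBra ξ).2.1

theorem inner_eq_inner_of_forall_slice {x y : E} {u v : corner E ξ}
    (h : ∀ η : H, ⟪u, slice ξ η x⟫_ℂ = ⟪v, slice ξ η y⟫_ℂ) :
    ⟪(u : E), x⟫_(compactOperators H) = ⟪(v : E), y⟫_(compactOperators H) := by
  rw [← sub_eq_zero]
  refine eq_zero_of_forall_ketBra_mul_eq_zero (ξ := (ξ : H)) (ne_zero_of_mem_unit_sphere ξ) ?_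
  intro η
  rw [mul_sub, ← CStarModule.inner_op_smul_right, ← CStarModule.inner_op_smul_right,
    ← coe_slice, ← coe_slice, inner_corner_eq_smul, inner_corner_eq_smul, h, sub_self]

theorem norm_slice_le (η : Metric.sphere (0 : H) 1) (x : E) : ‖slice ξ (η : H) x‖ ≤ ‖x‖ := by
  simpa [norm_ketBra] using norm_smul_le' _ (ketBra (ξ : H) η) x

theorem norm_le_of_forall_norm_slice_le {x : E} {C : ℝ} (hC : 0 ≤ C)
    (h : ∀ η : Metric.sphere (0 : H) 1, ‖slice ξ (η : H) x‖ ≤ C) : ‖x‖ ≤ C := by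
  have hpos : (0 : H →L[ℂ] H) ≤ (⟪x, x⟫_(compactOperators H) : H →L[ℂ] H) :=
    CStarModule.inner_self_nonneg (A := compactOperators H) (x := x)
  obtain ⟨s, hs⟩ := CStarAlgebra.nonneg_iff_eq_star_mul_self.1 hpos
  have hslice : ∀ η : H, ‖slice ξ η x‖ ^ 2 = ‖s η‖ ^ 2 := fun η => calc
    ‖slice ξ η x‖ ^ 2
        = ‖ketBra (ξ : H) η * ⟪x, x⟫_(compactOperators H) * ketBra η (ξ : H)‖ := by
          rw [Submodule.coe_norm, CStarModule.norm_sq_eq (compactOperators H)]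
          simp [mul_assoc]
    _ = ‖⟪η, (star s * s : H →L[ℂ] H) η⟫_ℂ‖ := by
          rw [ketBra_mul_mul_ketBra, hs, norm_smul, norm_ketBra]
          simp
    _ = ‖s η‖ ^ 2 := by
          simp [ContinuousLinearMap.star_eq_adjoint, ContinuousLinearMap.adjoint_inner_right]
  have hsC : ‖s‖ ≤ C := ContinuousLinearMap.opNorm_le_of_unit_norm hC fun η hη => by
    rw [← (pow_left_inj₀ (norm_nonneg _) (norm_nonneg _) two_ne_zero).1 (hslice η)]
    exact h ⟨η, mem_sphere_zero_iff_norm.2 hη⟩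
  refine le_of_sq_le_sq ?_ hC
  calc ‖x‖ ^ 2 = ‖(⟪x, x⟫_(compactOperators H) : H →L[ℂ] H)‖ :=
        CStarModule.norm_sq_eq (compactOperators H)
    _ = ‖s‖ ^ 2 := by rw [hs, CStarRing.norm_star_mul_self, sq]
    _ ≤ C ^ 2 := by gcongr

/-- The compression `T ↦ e T e` of the operators on `E` to `e E`. -/
def compression : (E →L[ℂ] E) →L[ℂ] corner E ξ →L[ℂ] corner E ξ :=
  ContinuousLinearMap.compL ℂ (corner E ξ) E (corner E ξ) (slice ξ (ξ : H)) ∘L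
    (ContinuousLinearMap.compL ℂ (corner E ξ) E E).flip (corner E ξ).subtypeL

theorem compression_apply (T : E →L[ℂ] E) (x : corner E ξ) :
    compression ξ T x = slice ξ (ξ : H) (T x) := rfl

theorem compression_slice {T : E →L[ℂ] E}
    (hT : ∀ (a : compactOperators H) (x : E), T (a • x) = a • T x) (η : H) (x : E) :
    compression ξ T (slice ξ η x) = slice ξ η (T x) := by
  rw [compression_apply, coe_slice, hT, ← coe_slice, slice_coe]

theorem compression_theta_ketBra_smul (x y : E) (η : H) :
    compression ξ (theta (compactOperators H) x (ketBra η η • y)) =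
      InnerProductSpace.rankOne ℂ (slice ξ η y) (slice ξ η x) := by
  ext z
  have hinner : ⟪x, (z : E)⟫_(compactOperators H) * ketBra η (ξ : H) =
      ⟪slice ξ η x, z⟫_ℂ • ketBra (ξ : H) ξ := by
    rw [← inner_corner_eq_smul, coe_slice, CStarModule.inner_op_smul_left, star_ketBra]
  change ketBra (ξ : H) ξ • ⟪x, (z : E)⟫_(compactOperators H) • ketBra η η • y =
    ⟪slice ξ η x, z⟫_ℂ • ketBra (ξ : H) η • y
  rw [← ketBra_smul_ketBra_smul ξ η η, ← mul_op_smul _ (ketBra η (ξ : H)), hinner, smul_op_smul,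
    op_smul_smul, ketBra_smul_ketBra_smul, ketBra_smul_ketBra_smul]

variable [CompleteSpace E]

theorem isCompactOperator_compression_theta (x y : E) :
    IsCompactOperator (compression ξ (theta (compactOperators H) x y)) := by
  let f : E →L[ℂ] corner E ξ →L[ℂ] corner E ξ := compression ξ ∘L
    (ContinuousLinearMap.compL ℂ E (compactOperators H) E).flip (CStarModule.innerSL x) ∘L
      (opSMulL (compactOperators H) E).flip
  let K : Submodule ℂ E :=
    (compactOperator (RingHom.id ℂ) (corner E ξ) (corner E ξ)).comap (f : E →ₗ[ℂ] _)
  have hK : IsClosed (K : Set E) := isClosed_setOfPred_isCompactOperator.preimage f.continuous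
  refine mem_of_forall_ketBra_smul_mem (H := H) (X := K) hK fun η => ?_
  change IsCompactOperator (compression ξ (theta (compactOperators H) x (ketBra (η : H) η • y)))
  rw [compression_theta_ketBra_smul]
  exact (ketBra _ _).2

theorem isCompactOperator_compression {k : E →L[ℂ] E}
    (hk : k ∈ moduleCompacts (compactOperators H) E) : IsCompactOperator (compression ξ k) := by
  let K : Submodule ℂ (E →L[ℂ] E) :=
    (compactOperator (RingHom.id ℂ) (corner E ξ) (corner E ξ)).comap
      (compression (E := E) ξ).toLinearMap
  have hK : IsClosed (K : Set (E →L[ℂ] E)) :=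
    (isClosed_setOfPred_isCompactOperator (M₁ := corner E ξ)).preimage (compression ξ).continuous
  refine Submodule.topologicalClosure_minimal _ (Submodule.span_le.2 ?_) hK hk
  rintro _ ⟨x, y, rfl⟩
  exact isCompactOperator_compression_theta ξ x y

end Corner

/-! ### Hilbert modules over the compact operators -/

section CompactOperatorModules

variable {H : Type*} [NormedAddCommGroup H] [InnerProductSpace ℂ H] [CompleteSpace H]
  {E : Type*} [NormedAddCommGroup E] [NormedSpace ℂ E]
  [SMul (compactOperators H) E] [CStarModule (compactOperators H) E]
  {X : Submodule ℂ E}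

theorem le_topologicalClosure_of_comap_corner_le (ξ : Metric.sphere (0 : H) 1)
    (hX : IsStable (compactOperators H) X) {Y : Submodule ℂ E}
    (hY : IsStable (compactOperators H) Y)
    (h : X.comap (corner E ξ).subtype ≤ Y.comap (corner E ξ).subtype) :
    X ≤ Y.topologicalClosure := by
  intro x hx
  refine mem_of_forall_ketBra_smul_mem (H := H) Y.isClosed_topologicalClosure fun η => ?_
  rw [← ketBra_smul_ketBra_smul ξ (η : H) η, ← coe_slice]
  exact Y.le_topologicalClosure (hY _ _ (h (x := slice ξ η x) (hX _ x hx)))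

theorem exists_finset_isOrthonormalBasis (ξ : Metric.sphere (0 : H) 1)
    (hX : IsStable (compactOperators H) X) [FiniteDimensional ℂ (X.comap (corner E ξ).subtype)] :
    ∃ B : Finset E, IsOrthonormalBasis (compactOperators H) (B : Set E) X := by
  classical
  let b := stdOrthonormalBasis ℂ (X.comap (corner E ξ).subtype)
  let v := fun i => ((b i : corner E ξ) : E)
  have hinner : ∀ i j, ⟪v i, v j⟫_(compactOperators H) =
      if i = j then ketBra (ξ : H) ξ else 0 := fun i j => by
    rw [inner_corner_eq_smul, ← Submodule.coe_inner, b.inner_eq_ite]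
    split_ifs <;> simp
  have hgen : X.comap (corner E ξ).subtype ≤
      (generatedSubmodule (compactOperators H) (Set.range v)).comap (corner E ξ).subtype := by
    intro x hx
    have hsum := congrArg (fun y : X.comap (corner E ξ).subtype => ((y : corner E ξ) : E))
      (b.sum_repr ⟨x, hx⟩)
    have hsum' : ∑ i, b.repr ⟨x, hx⟩ i • v i = (x : E) := by simpa using hsum
    change (x : E) ∈ generatedSubmodule _ _
    rw [← hsum']
    exact Submodule.sum_mem _ fun i _ =>
      Submodule.smul_mem _ _ (Submodule.subset_span (Or.inl ⟨i, rfl⟩))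
  refine ⟨Finset.univ.image v, ?_⟩
  rw [Finset.coe_image, Finset.coe_univ, Set.image_univ]
  refine ⟨?_, ⟨?_, ?_⟩,
    le_topologicalClosure_of_comap_corner_le ξ hX (isStable_generatedSubmodule _) hgen⟩
  · rintro _ ⟨i, rfl⟩
    exact (b i).2
  · rintro _ ⟨i, rfl⟩
    simpa [hinner] using isMinimalProjection_ketBra ξ
  · rintro _ ⟨i, rfl⟩ _ ⟨j, rfl⟩ hij
    rw [hinner, if_neg fun h => hij (congrArg v h.symm)]

theorem finiteOrthonormalDim_of_finiteDimensional (hX : IsStable (compactOperators H) X)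
    (h : ∀ ξ : Metric.sphere (0 : H) 1, FiniteDimensional ℂ (X.comap (corner E ξ).subtype)) :
    FiniteOrthonormalDim (compactOperators H) X := by
  refine finiteOrthonormalDim_iff.2 ?_
  rcases subsingleton_or_nonempty_sphere H E with hE | ⟨⟨ξ⟩⟩
  · refine ⟨∅, by simp, ⟨by simp, by simp⟩, fun x _ => subset_closure ?_⟩
    rw [Subsingleton.elim x 0]
    exact zero_mem _
  · have := h ξ
    exact exists_finset_isOrthonormalBasis ξ hX

theorem mem_perp_of_mem_orthogonal (ξ : Metric.sphere (0 : H) 1)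
    (hX : IsStable (compactOperators H) X) {v : corner E ξ}
    (hv : v ∈ (X.comap (corner E ξ).subtype)ᗮ) : (v : E) ∈ perp (compactOperators H) X := by
  intro x hx
  have h := inner_eq_inner_of_forall_slice ξ (x := x) (y := x) (u := v) (v := 0) fun η => by
    rw [inner_zero_left]
    exact Submodule.inner_left_of_mem_orthogonal (show slice ξ η x ∈ X.comap _ from hX _ x hx) hv
  simpa using h

variable [CompleteSpace E]

theorem map_fst_eq_top_of_corner {Γ : Submodule ℂ (E × E)} (hΓ : IsClosed (Γ : Set (E × E)))
    {C : ℝ} (hC : ∀ q ∈ Γ, ‖q.2‖ ≤ C * ‖q.1‖)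
    (h : ∀ (ξ : Metric.sphere (0 : H) 1) (x : corner E ξ), ∃ y, ((x : E), y) ∈ Γ) :
    Γ.map (LinearMap.fst ℂ E E) = ⊤ := by
  refine eq_top_iff.2 fun x _ =>
    mem_of_forall_ketBra_smul_mem (H := H) (isClosed_map_fst_of_norm_le hΓ hC) fun η => ?_
  obtain ⟨y, hy⟩ := h η ⟨_, ketBra_smul_mem_corner η η x⟩
  exact ⟨_, hy, rfl⟩

theorem isAdjointable_of_map_op_smul {T : E →L[ℂ] E}
    (hT : ∀ (a : compactOperators H) (x : E), T (a • x) = a • T x) :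
    IsAdjointable (compactOperators H) T := by
  have hmem : ∀ {y z : E}, (y, z) ∈ adjointGraph (compactOperators H) (everywhere (T : E →ₗ[ℂ] E)) ↔
      ∀ x, ⟪y, T x⟫_(compactOperators H) = ⟪z, x⟫_(compactOperators H) :=
    ⟨fun h x => h ⟨x, trivial⟩, fun h x => h x⟩
  have htop := map_fst_eq_top_of_corner (isClosed_adjointGraph (everywhere (T : E →ₗ[ℂ] E)))
    (C := ‖T‖) (fun ⟨y, z⟩ h => norm_le_of_norm_inner_self_le (compactOperators H) (by positivity)
      (by
        rw [← hmem.1 h]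
        calc ‖⟪y, T z⟫_(compactOperators H)‖ ≤ ‖y‖ * ‖T z‖ := CStarModule.norm_inner_le E
          _ ≤ ‖y‖ * (‖T‖ * ‖z‖) := by gcongr; exact T.le_opNorm z
          _ = ‖T‖ * ‖y‖ * ‖z‖ := by ring))
    (fun ξ y => ⟨((compression ξ T).adjoint y : corner E ξ), hmem.2 fun x => by
      refine inner_eq_inner_of_forall_slice ξ fun η => ?_
      rw [ContinuousLinearMap.adjoint_inner_left, compression_slice ξ hT]⟩)
  have hex : ∀ y, ∃ z, ∀ x, ⟪y, T x⟫_(compactOperators H) = ⟪z, x⟫_(compactOperators H) := by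
    intro y
    obtain ⟨⟨y, z⟩, h, rfl⟩ := htop.ge (Submodule.mem_top (x := y))
    exact ⟨z, hmem.1 h⟩
  choose S hS using hex
  exact ⟨S, fun x y => hS y x⟩

theorem exists_isOrthogonalProjection (hc : IsClosed (X : Set E))
    (hX : IsStable (compactOperators H) X) :
    ∃ p, IsOrthogonalProjection (compactOperators H) X p := by
  let Γ : Submodule ℂ (E × E) := X.comap (LinearMap.snd ℂ E E) ⊓
    (perp (compactOperators H) X).comap (LinearMap.fst ℂ E E - LinearMap.snd ℂ E E)
  have hΓ : IsClosed (Γ : Set (E × E)) := (hc.preimage continuous_snd).inter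
    ((isClosed_perp X).preimage (continuous_fst.sub continuous_snd))
  have hnorm : ∀ q ∈ Γ, ‖q.2‖ ≤ 1 * ‖q.1‖ := fun ⟨y, x⟩ ⟨hx, hxy⟩ => by
    rw [one_mul]
    refine norm_le_of_norm_inner_self_le (compactOperators H) (norm_nonneg _) ?_
    have h0 : ⟪y, x⟫_(compactOperators H) = ⟪x, x⟫_(compactOperators H) :=
      sub_eq_zero.1 (CStarModule.inner_sub_left.symm.trans (hxy x hx))
    rw [← h0]
    exact CStarModule.norm_inner_le E
  have htop : Γ.map (LinearMap.fst ℂ E E) = ⊤ := by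
    refine map_fst_eq_top_of_corner (H := H) hΓ hnorm fun ξ y => ?_
    let Y := X.comap (corner E ξ).subtype
    have : CompleteSpace Y := (hc.preimage continuous_subtype_val).completeSpace_coe
    exact ⟨(Y.starProjection y : corner E ξ), Y.starProjection_apply_mem y,
      mem_perp_of_mem_orthogonal ξ hX (Y.sub_starProjection_mem_orthogonal y)⟩
  obtain ⟨p, hp⟩ := exists_continuousLinearMap_of_isClosed hΓ
    (fun x hx => by simpa using hnorm _ hx) htop
  have hmem : ∀ y, (y, p y) ∈ Γ := fun y => (hp _ _).2 rfl
  exact ⟨p, fun y => (hmem y).1, fun y => (hmem y).2⟩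

theorem finiteOrthonormalDim_of_isCompactOperator (hX : IsStable (compactOperators H) X)
    (h : ∀ ξ : Metric.sphere (0 : H) 1, ∃ k : corner E ξ →L[ℂ] corner E ξ, IsCompactOperator k ∧
      ∀ x : corner E ξ, (x : E) ∈ X → k x = -x) :
    FiniteOrthonormalDim (compactOperators H) X := by
  refine finiteOrthonormalDim_of_finiteDimensional hX fun ξ => ?_
  obtain ⟨k, hk, hkX⟩ := h ξ
  have := ContinuousLinearMap.finite_dimensional_eigenspace hk (-1) (by simp)
  refine Submodule.finiteDimensional_of_le (S₂ := Module.End.eigenspace k.toLinearMap (-1)) ?_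
  intro x hx
  rw [Module.End.mem_eigenspace_iff]
  simpa using hkX x hx

variable {k : E →L[ℂ] E}

theorem finiteOrthonormalDim_perp (hk : k ∈ moduleCompacts (compactOperators H) E)
    (h : ∀ x, x + k x ∈ closure (X : Set E)) :
    FiniteOrthonormalDim (compactOperators H) (perp (compactOperators H) X) := by
  refine finiteOrthonormalDim_of_isCompactOperator (isStable_perp X) fun ξ =>
    ⟨star (compression ξ k), (compactOperators _).star_mem' (isCompactOperator_compression ξ hk),
      fun y hy => ?_⟩
  rw [eq_neg_iff_add_eq_zero, ContinuousLinearMap.star_eq_adjoint]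
  refine ext_inner_right ℂ fun v => ?_
  calc ⟪(compression ξ k).adjoint y + y, v⟫_ℂ
      = ⟪y, slice ξ (ξ : H) ((v : E) + k v)⟫_ℂ := by
        rw [inner_add_left, ContinuousLinearMap.adjoint_inner_left, compression_apply, map_add,
          slice_coe, inner_add_right, add_comm]
    _ = ⟪0, v⟫_ℂ := by
        rw [inner_slice_eq_zero ξ (inner_eq_zero_of_mem_closure hy (h v)), inner_zero_left]

variable {t : E →ₗ.[ℂ] E} {G : E →L[ℂ] E}

theorem finiteOrthonormalDim_kernel (ht : IsModuleLinear (compactOperators H) t)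
    (hk : k ∈ moduleCompacts (compactOperators H) E)
    (hG : ∀ x z, (x, z) ∈ t.graph → G z = x + k x) :
    FiniteOrthonormalDim (compactOperators H) (kernel t) := by
  refine finiteOrthonormalDim_of_isCompactOperator ht.isStable_kernel fun ξ =>
    ⟨compression ξ k, isCompactOperator_compression ξ hk, fun x hx => ?_⟩
  have h0 : k x = -x := by
    rw [eq_neg_iff_add_eq_zero, add_comm, ← hG x 0 (mem_kernel.1 hx), map_zero]
  rw [compression_apply, h0, map_neg, slice_coe]

theorem exists_norm_le_of_mem_moorePenroseGraph (ht : IsModuleLinear (compactOperators H) t)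
    (hc : t.IsClosed) (hk : k ∈ moduleCompacts (compactOperators H) E)
    (hG : ∀ x z, (x, z) ∈ t.graph → G z = x + k x) :
    ∃ C : ℝ, ∀ q ∈ moorePenroseGraph (compactOperators H) t, ‖q.2‖ ≤ C * ‖q.1‖ := by
  rcases subsingleton_or_nonempty_sphere H E with hE | ⟨⟨ξ⟩⟩
  · exact ⟨0, fun q _ => by simp [Subsingleton.elim q.2 0]⟩
  let Γ : Submodule ℂ (corner E ξ × corner E ξ) := (moorePenroseGraph (compactOperators H) t).comap
    ((corner E ξ).subtype.prodMap (corner E ξ).subtype)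
  have hΓ : IsClosed (Γ : Set (corner E ξ × corner E ξ)) :=
    (isClosed_moorePenroseGraph hc).preimage
      (continuous_subtype_val.prodMap continuous_subtype_val)
  obtain ⟨C, hC, hbound⟩ := exists_norm_le_of_isCompactOperator hΓ
    (S := compression ξ G) (k := compression ξ k)
    (fun x hx => Subtype.ext (eq_zero_of_zero_mem_moorePenroseGraph hx))
    (isCompactOperator_compression ξ hk)
    (fun q hq => by
      have hq' : G q.1 = q.2 + k q.2 := hG _ _ hq.1
      rw [compression_apply, compression_apply, hq', map_add, slice_coe])
  refine ⟨C, fun q hq => norm_le_of_forall_norm_slice_le ξ (by positivity) fun η => ?_⟩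
  calc ‖slice ξ (η : H) q.2‖ ≤ C * ‖slice ξ (η : H) q.1‖ :=
        hbound (slice ξ η q.1, slice ξ η q.2) (isStable_moorePenroseGraph ht (ketBra ξ η) q hq)
    _ ≤ C * ‖q.1‖ := by gcongr; exact norm_slice_le ξ η q.1

theorem isClosed_ran (ht : IsModuleLinear (compactOperators H) t) (hc : t.IsClosed)
    (hk : k ∈ moduleCompacts (compactOperators H) E)
    (hG : ∀ x z, (x, z) ∈ t.graph → G z = x + k x) : IsClosed (ran t : Set E) := by
  obtain ⟨p, hp⟩ := exists_isOrthogonalProjection (isClosed_kernel hc) ht.isStable_kernel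
  obtain ⟨C, hC⟩ := exists_norm_le_of_mem_moorePenroseGraph ht hc hk hG
  rw [← map_fst_moorePenroseGraph hp]
  exact isClosed_map_fst_of_norm_le (isClosed_moorePenroseGraph hc) hC

theorem isFredholm_of_isClosed_ran (ht : IsModuleLinear (compactOperators H) t)
    (hc : t.IsClosed) (hd : Dense (t.domain : Set E)) (hran : IsClosed (ran t : Set E))
    (hker : FiniteOrthonormalDim (compactOperators H) (kernel t))
    (hcoker : FiniteOrthonormalDim (compactOperators H) (perp (compactOperators H) (ran t))) :
    IsFredholm (compactOperators H) t := by
  obtain ⟨p, hp⟩ := exists_isOrthogonalProjection (isClosed_kernel hc) ht.isStable_kernel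
  obtain ⟨q, hq⟩ := exists_isOrthogonalProjection hran ht.isStable_ran
  obtain ⟨G, hG, hGt, htG⟩ := exists_moorePenroseInverse ht hc hp hq
  have hGa := isAdjointable_of_map_op_smul hG
  refine ⟨⟨G, ?_⟩, G, ?_⟩
  · exact isPseudoLeftInverse_of_apply_eq_sub hd hGa hp.isAdjointable
      (hp.mem_moduleCompacts ht.isStable_kernel hker) hGt
  · exact isPseudoRightInverse_of_mem_graph hGa hq.one_sub.isAdjointable
      (hq.one_sub.mem_moduleCompacts (isStable_perp _) hcoker) fun y => by simpa using htG y

end CompactOperatorModules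

end HilbertModule

end

theorem theorem4p3_general {H : Type*} [NormedAddCommGroup H] [InnerProductSpace ℂ H]
    [CompleteSpace H] {E : Type*} [NormedAddCommGroup E] [NormedSpace ℂ E] [CompleteSpace E]
    [SMul (compactOperators H) E] [CStarModule (compactOperators H) E] (t : E →ₗ.[ℂ] E)
    (ht : HilbertModule.IsModuleLinear (compactOperators H) t) (hc : t.IsClosed)
    (hd : Dense (t.domain : Set E)) :
    HilbertModule.IsFredholm (compactOperators H) t ↔
      IsClosed (HilbertModule.ran t : Set E) ∧
        HilbertModule.FiniteOrthonormalDim (compactOperators H) (HilbertModule.kernel t) ∧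
        HilbertModule.FiniteOrthonormalDim (compactOperators H)
          (HilbertModule.kernel (HilbertModule.adjoint (compactOperators H) t)) := by
  rw [HilbertModule.kernel_adjoint hd]
  constructor
  · rintro ⟨⟨G, hG⟩, ⟨G', hG'⟩⟩
    obtain ⟨k, hk, hGk⟩ := hG.exists_apply_eq_add
    obtain ⟨k', hk', hGk'⟩ := hG'.exists_add_mem_closure_ran
    exact ⟨HilbertModule.isClosed_ran ht hc hk hGk,
      HilbertModule.finiteOrthonormalDim_kernel ht hk hGk,
      HilbertModule.finiteOrthonormalDim_perp hk' hGk'⟩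
  · rintro ⟨hran, hker, hcoker⟩
    exact HilbertModule.isFredholm_of_isClosed_ran ht hc hd hran hker hcoker

theorem theorem4p3 {H : Type*} [NormedAddCommGroup H] [InnerProductSpace ℂ H] [CompleteSpace H]
    {E : Type*} [NormedAddCommGroup E] [NormedSpace ℂ E] [CompleteSpace E]
    [SMul (compactOperators H) E] [CStarModule (compactOperators H) E]
    (t : E →ₗ.[ℂ] E) (ht : HilbertModule.IsRegular (compactOperators H) t) :
    HilbertModule.IsFredholm (compactOperators H) t ↔
      IsClosed (HilbertModule.ran t : Set E) ∧
        HilbertModule.FiniteOrthonormalDim (compactOperators H) (HilbertModule.kernel t) ∧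
        HilbertModule.FiniteOrthonormalDim (compactOperators H)
          (HilbertModule.kernel (HilbertModule.adjoint (compactOperators H) t)) :=
  theorem4p3_general t ht.moduleLinear ht.closed ht.dense_domain
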